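/- \textbf{The game.} Let $\alpha\ge 0$ and let $G=(V,E)$ be a host graph with $V=\{1,\dots,n\}$. Each vertex is a player, and a joint strategy $s$ assigns to every player $i$ and every $e\in E$ an offer $s(i,e)\ge 0$. The created graph $G_s=(V,E_s)$ has $E_s=\{e\in E:\sum_{k} s(k,e)\ge\alpha\}$. For $e\in E_s$ player $i$ pays $s'(i,e)=\alpha\, s(i,e)/\sum_k s(k,e)$ (and $0$ if $\alpha=0$). The cost of player $i$ is $$c_i(s)=\sum_{e\in E_s}s'(i,e)+\sum_{j=1}^n d_{G_s}(i,j),$$ and the total cost is $$c(s)=\alpha|E_s|+\sum_{i=1}^n\sum_{j=1}^n d_{G_s}(i,j),$$ where $d_{G_s}$ is the graph distance ($\infty$ between different components). A joint strategy $s$ is a \emph{collaborative equilibrium} if all costs $c_i(s)$ are finite (for $n \ge 1$: $G_s$ is connected) and, for every $e\in E$, every nonempty coalition $C\subseteq V$ and every joint strategy $t$ that differs from $s$ at most in the offers $t(i,e)$ with $i\in C$, some $i\in C$ has $c_i(t)\ge c_i(s)$; that is, no coalition can change its offers on a single link so that all its members become strictly better off. The \emph{price of anarchy} is the supremum of $c(s)$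 over all collaborative equilibria $s$ divided by the minimum of $c(t)$ over all joint strategies $t$ (read as $0$ when the quotient is $0/0$, i.e. when $n\le 1$). \textbf{Theorem.} For every $c>0$ there is a constant $K>0$, depending only on $c$, such that for every $n$ and every $\alpha$ with $0\le\alpha\le cn$, in the cooperative network creation game on the complete host graph on $n$ vertices with link cost $\alpha$: \begin{enumerate} \item for every collaborative equilibrium $s$, the graph $G_s$ has diameter at most $K\,(\lg n)^{\lg 5}$; \item the price of anarchy is at most $K\,(\lg n)^{1+\lg 5}$. \end{enumerate} Here $\lg=\log_2$ (with the right-hand sides read as $0$ when $n\le 1$). -/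

import Mathlib

open scoped NNReal ENNReal

namespace CooperativeNetworkCreation

variable {V : Type*} [Fintype V] {G : SimpleGraph V}

/-- A joint strategy of the cooperative network creation game on the host graph `G`:
`s i e` is the (nonnegative) value that player `i` is willing to pay for the link `e`. -/
abbrev JointStrategy (G : SimpleGraph V) : Type _ := V → G.edgeSet → ℝ≥0

/-- The total amount offered for the link `e`. -/
noncomputable def totalOffer (s : JointStrategy G) (e : G.edgeSet) : ℝ≥0 := ∑ i, s i e

/-- The created graph `G_s`: the spanning subgraph of the host graph consisting of the links
for which the total offer is at least `α`. -/
def createdGraph (α : ℝ≥0) (s : JointStrategy G) : SimpleGraph V :=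
  SimpleGraph.fromEdgeSet {e | ∃ h : e ∈ G.edgeSet, α ≤ totalOffer s ⟨e, h⟩}

/-- The amount that player `i` actually pays for the link `e`: nothing if the link is not created;
otherwise the offers are scaled uniformly so that they sum to `α`
(no scaling takes place if they already sum to `α`). -/
noncomputable def payment (α : ℝ≥0) (s : JointStrategy G) (i : V) (e : G.edgeSet) : ℝ≥0 :=
  if α ≤ totalOffer s e then α * s i e / totalOffer s e else 0

/-- The usage cost of vertex `i` in a graph: the sum of its distances to all vertices,
the distance between vertices in different components being `∞`. -/
noncomputable def usageCost (H : SimpleGraph V) (i : V) : ℝ≥0∞ :=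
  ∑ j, (H.edist i j : ℝ≥0∞)

open Classical in
/-- The cost `c_i(s)` incurred by player `i`. -/
noncomputable def playerCost (α : ℝ≥0) (s : JointStrategy G) (i : V) : ℝ≥0∞ :=
  ∑ e : G.edgeSet, (payment α s i e : ℝ≥0∞) + usageCost (createdGraph α s) i

/-- The total cost `c(s) = α |E_s| + ∑ i, ∑ j, d(i, j)`. -/
noncomputable def totalCost (α : ℝ≥0) (s : JointStrategy G) : ℝ≥0∞ :=
  (α : ℝ≥0∞) * ((createdGraph α s).edgeSet.ncard : ℝ≥0∞)
    + ∑ i, usageCost (createdGraph α s) i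

/-- Collaborative equilibrium: all costs are finite (that is, the created graph is connected),
and no nonempty coalition `C` can change its offers on one link `e` of the host graph so that
every member of `C` becomes strictly better off. -/
def IsCollaborativeEquilibrium (α : ℝ≥0) (s : JointStrategy G) : Prop :=
  (∀ i, playerCost α s i ≠ ∞) ∧
  ∀ (e : G.edgeSet) (C : Finset V), C.Nonempty →
    ∀ t : JointStrategy G, (∀ i f, t i f ≠ s i f → i ∈ C ∧ f = e) →
      ∃ i ∈ C, playerCost α s i ≤ playerCost α t i

/-- The price of anarchy: the maximum (supremum) of the total cost over the collaborative
equilibria, divided by the minimum of the total cost over all joint strategies. -/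
noncomputable def priceOfAnarchy (G : SimpleGraph V) (α : ℝ≥0) : ℝ≥0∞ :=
  (⨆ s : {s : JointStrategy G // IsCollaborativeEquilibrium α s}, totalCost α s.1) /
    (⨅ s : JointStrategy G, totalCost α s)

end CooperativeNetworkCreation

/-! Diameter. If one new link would shorten every distance between `W` and `Z` by at least `m`, then
|W||Z|m ≤ α ≤ cn; otherwise the members of `W` could split its price and all gain
(`sum_le_of_usageCost_add_le`, `card_mul_card_mul_le`). Packing disjoint balls around a sphere turns
this into growth: while balls of radius 4k+1 hold at most half of the vertices, the size of a ball
of radius 5k+2 is, up to 2c, at least the square of the size at radius k (`sq_le_card_distBall`).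
The radius grows about fivefold whenever the logarithm of the size doubles, so within about lg lg n
rounds some ball holds more than half of V, at radius of order 5^(lg lg n) = (lg n)^(lg 5). Every
vertex is close to its centre, since a link to the centre would shorten its distances to over n/2
vertices.

Price of anarchy. Put L = 2 log n + 1. Nobody pays more for a link than its deletion would cost
them, and deletion lengthens only the shortest paths through it; so the links with a detour of
length at most L cost in total at most L times the usage cost (`mul_card_le_of_detour`). The other
links lie on no short cycle, hence number at most 2n (`ncard_edgeSet_le_of_forall_lt_edist`). The
total is thus at most 2αn plus O(log n) times the usage cost, which is at most n² times the
diameter, whereas every strategy costs at least (αn + n²)/2. -/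

namespace SimpleGraph

/-! ### Graphs without short cycles have few edges -/

variable {V : Type*}

/-- In a graph in which deleting any edge leaves its endpoints at large distance, every vertex `y`
has at most one neighbour that is not farther than `y` from a given vertex `v`. -/
lemma eq_of_adj_of_edist_le {F : SimpleGraph V} {L : ℕ}
    (hF : ∀ x y, F.Adj x y → (L : ℕ∞) < (F.deleteEdges {s(x, y)}).edist x y)
    {v x x' y : V} {r : ℕ} (hr : 2 * r + 1 ≤ L) (hxy : F.Adj x y) (hx'y : F.Adj x' y)
    (hx : F.edist v x ≤ r) (hx' : F.edist v x' ≤ r)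
    (hle : F.edist v x ≤ F.edist v y) (hle' : F.edist v x' ≤ F.edist v y) : x = x' := by
  classical
  by_contra hne
  have key : ∀ z, F.edist v z ≤ r → F.edist v z ≤ F.edist v y → F.Adj z y →
      (F.deleteEdges {s(x, y)}).edist v z ≤ r := by
    intro z hz hzy hadj
    obtain ⟨p, hp⟩ := exists_walk_of_edist_ne_top (ne_top_of_le_ne_top (by simp) hz)
    -- A shortest walk to `z` through the neighbour `y` of `z` would make `y` strictly closer to `v`
    -- than `z`.
    have hy : y ∉ p.support := by
      intro hy
      have h1 := p.length_takeUntil_lt_length hy hadj.ne'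
      have h2 := F.edist_le (p.takeUntil y hy)
      rw [← hp] at hzy
      have h3 := hzy.trans h2
      norm_cast at h3
      omega
    have he : s(x, y) ∉ p.edges := fun h => hy (p.snd_mem_support_of_mem_edges h)
    refine (edist_le (p.toDeleteEdge _ he)).trans ?_
    rw [Walk.toDeleteEdge, Walk.length_transfer, hp]
    exact hz
  have h1 := key x hx hle hxy
  have h2 := key x' hx' hle' hx'y
  have h3 : (F.deleteEdges {s(x, y)}).edist x' y ≤ 1 := by
    rw [edist_le_one_iff_adj_or_eq, deleteEdges_adj]
    left
    refine ⟨hx'y, ?_⟩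
    simp only [Set.mem_singleton_iff, Sym2.eq_iff, not_or, not_and]
    exact ⟨fun h => absurd h.symm hne, fun h => absurd h hx'y.ne⟩
  have h4 := hF x y hxy
  -- The route `x`, `v`, `x'`, `y` avoids the edge `xy` and has length at most 2r+1 ≤ L.
  have h5 : (F.deleteEdges {s(x, y)}).edist x y ≤ ((2 * r + 1 : ℕ) : ℕ∞) := by
    refine (SimpleGraph.edist_triangle (v := x')).trans ?_
    refine (add_le_add (SimpleGraph.edist_triangle (v := v)) h3).trans ?_
    rw [edist_comm (u := x)]
    refine (add_le_add_left (add_le_add h1 h2) 1).trans ?_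
    push_cast
    rw [two_mul]
  have h6 := h4.trans_le h5
  norm_cast at h6
  omega

/-- A graph on `n` vertices in which deleting any edge leaves its endpoints at distance more than
`2 * log n + 1` has at most two edges per non-isolated vertex. -/
lemma ncard_edgeSet_le_of_forall_lt_edist [Fintype V] {L : ℕ} (hL : 2 * Nat.log 2 (Fintype.card V) + 1 ≤ L) :
    ∀ (m : ℕ) (S : Finset V) (F : SimpleGraph V), S.card ≤ m →
    (∀ x y, F.Adj x y → (L : ℕ∞) < (F.deleteEdges {s(x, y)}).edist x y) →
    (∀ x y, F.Adj x y → x ∈ S) → F.edgeSet.ncard ≤ 2 * S.card := by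
  classical
  intro m
  induction m with
  | zero =>
    intro S F hS _ hFS
    have hS' : S = ∅ := Finset.card_eq_zero.mp (by omega)
    subst hS'
    have : F = ⊥ := by
      ext x y
      exact ⟨fun h => absurd (hFS x y h) (by simp), fun h => h.elim⟩
    subst this
    simp
  | succ m ih =>
    intro S F hS hF hFS
    rcases S.eq_empty_or_nonempty with rfl | ⟨v, hv⟩
    · exact ih ∅ F (by simp) hF hFS
    let B : ℕ → Finset V := fun r => S.filter (fun w => F.edist v w ≤ r)
    -- Otherwise the balls double log n + 1 times and outgrow `V`.
    have hgrow : ∃ r ≤ Nat.log 2 (Fintype.card V), (B (r + 1)).card ≤ 2 * (B r).card := by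
      by_contra! h
      have hpow : ∀ r ≤ Nat.log 2 (Fintype.card V) + 1, 2 ^ r ≤ (B r).card := by
        intro r
        induction r with
        | zero =>
          intro _
          exact Finset.card_pos.mpr ⟨v, by simp [B, hv]⟩
        | succ r ihr =>
          intro hr
          have h1 := ihr (by omega)
          have h2 := h r (by omega)
          rw [pow_succ]
          omega
      have h1 := hpow _ le_rfl
      have h2 := Nat.lt_pow_succ_log_self (b := 2) (by norm_num) (Fintype.card V)
      have h3 := Finset.card_le_univ (B (Nat.log 2 (Fintype.card V) + 1))
      omega
    obtain ⟨r, hr, hB⟩ := hgrow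
    let F' : SimpleGraph V :=
      { Adj := fun x y => F.Adj x y ∧ x ∉ B r ∧ y ∉ B r
        symm := ⟨fun x y h => ⟨h.1.symm, h.2.2, h.2.1⟩⟩
        loopless := ⟨fun x h => h.1.ne rfl⟩ }
    have hF'F : F' ≤ F := fun x y h => h.1
    have hvB : v ∈ B r := by simp [B, hv]
    have hBS : B r ⊆ S := Finset.filter_subset _ _
    have hcard : (S \ B r).card + (B r).card = S.card := Finset.card_sdiff_add_card_eq_card hBS
    have hpos : 0 < (B r).card := Finset.card_pos.mpr ⟨v, hvB⟩
    have h1 : F'.edgeSet.ncard ≤ 2 * (S \ B r).card := by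
      refine ih _ F' (by omega) ?_ ?_
      · intro x y h
        exact (hF x y h.1).trans_le (edist_anti (deleteEdges_mono hF'F))
      · intro x y h
        exact Finset.mem_sdiff.mpr ⟨hFS x y h.1, h.2.1⟩
    -- Charge each edge meeting `B r` to an endpoint at least as far from `v` as the other one; it
    -- lies in `B (r + 1)` and is charged only once.
    have h2 : (F.edgeFinset \ F'.edgeFinset).card ≤ (B (r + 1)).card := by
      refine Finset.card_le_card_of_forall_subsingleton
        (fun e y => ∃ x, e = s(x, y) ∧ x ∈ B r ∧ F.Adj x y ∧ F.edist v x ≤ F.edist v y) ?_ ?_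
      · have main : ∀ x y, F.Adj x y → x ∈ B r → ∃ z ∈ B (r + 1), ∃ w, s(x, y) = s(w, z) ∧
            w ∈ B r ∧ F.Adj w z ∧ F.edist v w ≤ F.edist v z := by
          intro x y hxy hx
          have hxr : F.edist v x ≤ r := (Finset.mem_filter.mp hx).2
          rcases le_total (F.edist v x) (F.edist v y) with hle | hle
          · refine ⟨y, Finset.mem_filter.mpr ⟨hFS y x hxy.symm, ?_⟩, x, rfl, hx, hxy, hle⟩
            refine (SimpleGraph.edist_triangle (v := x)).trans ?_
            push_cast
            exact add_le_add hxr (edist_eq_one_iff_adj.mpr hxy).le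
          · refine ⟨x, Finset.mem_filter.mpr ⟨hFS x y hxy, hxr.trans (by norm_cast; omega)⟩, y,
              Sym2.eq_swap, Finset.mem_filter.mpr ⟨hFS y x hxy.symm, hle.trans hxr⟩,
              hxy.symm, hle⟩
        intro e he
        induction e with
        | _ x y =>
          simp only [Finset.mem_sdiff, mem_edgeFinset, mem_edgeSet] at he
          obtain ⟨hxy, hn⟩ := he
          by_cases hx : x ∈ B r
          · exact main x y hxy hx
          · have hy : y ∈ B r := by
              by_contra hy
              exact hn ⟨hxy, hx, hy⟩
            obtain ⟨z, hz, w, hw, h⟩ := main y x hxy.symm hy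
            exact ⟨z, hz, w, by rw [Sym2.eq_swap, hw], h⟩
      · rintro y - e ⟨-, x, rfl, hx, hxy, hle⟩ e' ⟨-, x', rfl, hx', hx'y, hle'⟩
        rw [eq_of_adj_of_edist_le hF (r := r) (by omega) hxy hx'y (Finset.mem_filter.mp hx).2
          (Finset.mem_filter.mp hx').2 hle hle']
    have h3 := Finset.card_le_card_sdiff_add_card (s := F.edgeFinset) (t := F'.edgeFinset)
    rw [← coe_edgeFinset, Set.ncard_coe_finset] at h1 ⊢
    omega

/-! ### Distances after deleting an edge -/

/-- Deleting an edge of a walk without repeated edges lengthens the distance between its ends by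
at most the length of a detour around that edge. -/
lemma edist_deleteEdges_le_of_isTrail {H : SimpleGraph V} {e : Sym2 V} {L : ℕ}
    (he : ∀ x y, e = s(x, y) → (H.deleteEdges {e}).edist x y ≤ L) {i j : V} (p : H.Walk i j)
    (hp : p.IsTrail) : (H.deleteEdges {e}).edist i j ≤ p.length + (L : ℕ∞) := by
  classical
  induction p with
  | nil => simp
  | @cons u v w h q ih =>
    rw [Walk.isTrail_cons] at hp
    refine (SimpleGraph.edist_triangle (v := v)).trans ?_
    by_cases hue : e = s(u, v)
    · have h1 : e ∉ q.edges := hue ▸ hp.2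
      have h2 := edist_le (q.toDeleteEdge e h1)
      rw [Walk.toDeleteEdge, Walk.length_transfer] at h2
      refine (add_le_add (he u v hue) h2).trans ?_
      rw [Walk.length_cons]
      norm_cast
      omega
    · have h1 : (H.deleteEdges {e}).edist u v ≤ 1 := by
        rw [edist_le_one_iff_adj_or_eq, deleteEdges_adj]
        exact Or.inl ⟨h, fun h' => hue (Set.mem_singleton_iff.mp h').symm⟩
      refine (add_le_add h1 (ih hp.1)).trans ?_
      rw [Walk.length_cons]
      push_cast
      rw [← add_assoc, add_comm 1]

lemma edist_deleteEdges_le_of_notMem {H : SimpleGraph V} {e : Sym2 V} {i j : V} (p : H.Walk i j)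
    (hp : e ∉ p.edges) : (H.deleteEdges {e}).edist i j ≤ p.length := by
  have h := edist_le (p.toDeleteEdge e hp)
  rwa [Walk.toDeleteEdge, Walk.length_transfer] at h

/-! ### Growth of balls and the diameter -/

lemma Connected.exists_dist_eq {H : SimpleGraph V} (hH : H.Connected) {u v : V} {k : ℕ}
    (hk : k ≤ H.dist u v) : ∃ a, H.dist u a = k ∧ H.dist u a + H.dist a v = H.dist u v := by
  obtain ⟨p, hp⟩ := hH.exists_walk_length_eq_dist u v
  refine ⟨p.getVert k, ?_⟩
  have h1 := dist_le (p.take k)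
  have h2 := dist_le (p.drop k)
  have h3 := hH.dist_triangle (u := u) (v := p.getVert k) (w := v)
  rw [Walk.take_length] at h1
  rw [Walk.drop_length] at h2
  omega

open Classical in
/-- The set of vertices at distance at most `k` from `u`. -/
noncomputable def distBall [Fintype V] (H : SimpleGraph V) (u : V) (k : ℕ) : Finset V :=
  Finset.univ.filter fun w => H.dist u w ≤ k

@[simp] lemma mem_distBall [Fintype V] {H : SimpleGraph V} {u w : V} {k : ℕ} :
    w ∈ H.distBall u k ↔ H.dist u w ≤ k := by simp [distBall]

lemma Connected.lt_card_distBall [Fintype V] {H : SimpleGraph V} (hH : H.Connected) {u v : V} {k : ℕ}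
    (hk : k ≤ H.dist u v) : k < (H.distBall u k).card := by
  have h : ∀ i : Fin (k + 1), ∃ a, H.dist u a = i := fun i =>
    (hH.exists_dist_eq (show (i : ℕ) ≤ H.dist u v by omega)).imp fun _ h => h.1
  choose a ha using h
  have := Finset.card_le_card_of_injOn (s := Finset.univ) (t := H.distBall u k) a
    (fun i _ => by simp only [mem_distBall, ha, Finset.mem_coe]; omega)
    (fun i _ j _ hij => Fin.ext (by rw [← ha i, ← ha j, hij]))
  simpa using this

/-- If no two sets of vertices that a new edge brings closer are too large, then balls grow
quadratically. -/
lemma Connected.sq_le_card_distBall [Fintype V] {H : SimpleGraph V} (hH : H.Connected) {c : ℝ}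
    (hadd : ∀ (W Z : Finset V) (u x : V), (∀ w ∈ W, ∀ z ∈ Z,
      H.dist w u + 1 + H.dist x z + 1 ≤ H.dist w z) →
      (W.card : ℝ) * Z.card ≤ c * Fintype.card V)
    {k : ℕ} {N : ℝ} (hN : 0 ≤ N) (hball : ∀ u, N ≤ (H.distBall u k).card) (u : V)
    (hhalf : ((H.distBall u (4 * k + 1)).card : ℝ) ≤ Fintype.card V / 2) :
    N ^ 2 ≤ 2 * c * (H.distBall u (5 * k + 2)).card := by
  classical
  let A : Finset V := Finset.univ.filter fun a => H.dist u a = 4 * k + 2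
  let sep : Finset V → Prop := fun X => ∀ x ∈ X, ∀ y ∈ X, x ≠ y → 2 * k < H.dist x y
  obtain ⟨X, hX, hmax⟩ := (A.powerset.filter sep).exists_max_image Finset.card
    ⟨∅, by simp [sep]⟩
  simp only [Finset.mem_filter, Finset.mem_powerset] at hX hmax
  obtain ⟨hXA, hXsep⟩ := hX
  have hnear : ∀ a ∈ A, ∃ x ∈ X, H.dist x a ≤ 2 * k := by
    intro a ha
    by_contra! h
    have haX : a ∉ X := fun haX => by simpa using h a haX
    have h1 := hmax (insert a X) ⟨Finset.insert_subset ha hXA, by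
      intro x hx y hy hxy
      rw [Finset.mem_insert] at hx hy
      rcases hx with rfl | hx <;> rcases hy with rfl | hy
      · exact absurd rfl hxy
      · rw [dist_comm]; exact h y hy
      · exact h x hx
      · exact hXsep x hx y hy hxy⟩
    rw [Finset.card_insert_of_notMem haX] at h1
    omega
  let Z : V → Finset V := fun x =>
    Finset.univ.filter fun z => H.dist x z + 2 * k + 2 ≤ H.dist u z
  -- A shortest path from `u` to `z` crosses the sphere `A` at a point within 2k of some `x` in `X`,
  -- by maximality of `X`; of the 4k+2 steps up to `A`, 2k+2 are saved.
  have hcover : (H.distBall u (4 * k + 1))ᶜ ⊆ X.biUnion Z := by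
    intro z hz
    rw [Finset.mem_compl, mem_distBall, not_le] at hz
    obtain ⟨a, ha, haz⟩ := hH.exists_dist_eq (show 4 * k + 2 ≤ H.dist u z by omega)
    obtain ⟨x, hx, hxa⟩ := hnear a (by simp [A, ha])
    refine Finset.mem_biUnion.mpr ⟨x, hx, ?_⟩
    have := hH.dist_triangle (u := x) (v := a) (w := z)
    simp only [Z, Finset.mem_filter, Finset.mem_univ, true_and]
    omega
  -- The slack 2k+2 in `Z x` covers twice the distance from `u` to `w`, the new link `ux`, and a
  -- gain of one.
  have hZ : ∀ x ∈ X, ((H.distBall u k).card : ℝ) * (Z x).card ≤ c * Fintype.card V := by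
    intro x _
    refine hadd _ _ u x ?_
    intro w hw z hz
    simp only [Z, Finset.mem_filter, Finset.mem_univ, true_and, mem_distBall] at hw hz
    have := hH.dist_triangle (u := u) (v := w) (w := z)
    rw [dist_comm (u := w) (v := u)]
    omega
  have hcompl : ((H.distBall u (4 * k + 1))ᶜ.card : ℝ) ≤ ∑ x ∈ X, ((Z x).card : ℝ) := by
    exact_mod_cast (Finset.card_le_card hcover).trans Finset.card_biUnion_le
  rw [Finset.card_compl, Nat.cast_sub (Finset.card_le_univ _)] at hcompl
  have hsum : ((H.distBall u k).card : ℝ) * ∑ x ∈ X, ((Z x).card : ℝ) ≤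
      X.card * (c * Fintype.card V) := by
    rw [Finset.mul_sum, ← nsmul_eq_mul]
    exact Finset.sum_le_card_nsmul _ _ _ hZ
  have hpack : (X.card : ℝ) * N ≤ (H.distBall u (5 * k + 2)).card := by
    have hsub : X.biUnion (fun x => H.distBall x k) ⊆ H.distBall u (5 * k + 2) := by
      intro z hz
      obtain ⟨x, hx, hxz⟩ := Finset.mem_biUnion.mp hz
      have hxA := hXA hx
      simp only [A, Finset.mem_filter, Finset.mem_univ, true_and, mem_distBall] at hxA hxz ⊢
      have := hH.dist_triangle (u := u) (v := x) (w := z)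
      omega
    have h1 := Finset.card_le_card hsub
    rw [Finset.card_biUnion] at h1
    · have h2 : (X.card : ℝ) * N ≤ ∑ x ∈ X, ((H.distBall x k).card : ℝ) := by
        rw [← nsmul_eq_mul]
        exact Finset.card_nsmul_le_sum _ _ _ fun x _ => hball x
      exact h2.trans (by exact_mod_cast h1)
    · intro x hx y hy hxy
      rw [Function.onFun, Finset.disjoint_left]
      intro z hzx hzy
      rw [mem_distBall] at hzx hzy
      have h2 := hXsep x hx y hy hxy
      have h3 := hH.dist_triangle (u := x) (v := z) (w := y)
      rw [dist_comm (u := z)] at h3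
      omega
  have hn : (0 : ℝ) < Fintype.card V := by
    have : Nonempty V := ⟨u⟩
    exact_mod_cast Fintype.card_pos
  have hc : 0 ≤ c := by
    by_contra! hc
    have h1 := hadd ∅ ∅ u u (by simp)
    simp only [Finset.card_empty, Nat.cast_zero, zero_mul] at h1
    nlinarith
  have h1 : (H.distBall u k).card * ((Fintype.card V : ℝ) / 2) ≤
      X.card * (c * Fintype.card V) :=
    (mul_le_mul_of_nonneg_left (by linarith) (Nat.cast_nonneg _)).trans hsum
  have h2 : ((H.distBall u k).card : ℝ) ≤ 2 * c * X.card :=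
    le_of_mul_le_mul_right (by linarith) hn
  calc N ^ 2 = N * N := sq N
    _ ≤ (2 * c * X.card) * N := mul_le_mul_of_nonneg_right ((hball u).trans h2) hN
    _ = 2 * c * (X.card * N) := by ring
    _ ≤ _ := mul_le_mul_of_nonneg_left hpack (by positivity)

end SimpleGraph

namespace SimpleGraph

/-- If no two sets of vertices that a new edge brings closer are too large, then the diameter is
small. -/
lemma Connected.dist_le_of_forall_card_mul_card_le {V : Type*} [Fintype V] {H : SimpleGraph V}
    (hH : H.Connected) {c : ℝ} (hc : 1 ≤ c)
    (hadd : ∀ (W Z : Finset V) (u x : V) (m : ℕ), (∀ w ∈ W, ∀ z ∈ Z,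
      H.dist w u + 1 + H.dist x z + m ≤ H.dist w z) →
      (W.card : ℝ) * Z.card * m ≤ c * Fintype.card V)
    {J : ℕ} (hJ : Fintype.card V ≤ 2 ^ 2 ^ J) (v w : V) :
    (H.dist v w : ℝ) ≤ 20 * (4 * c + 2) * 5 ^ J := by
  classical
  obtain ⟨κ, hκ0, hκ⟩ : ∃ κ : ℕ → ℕ, κ 0 = ⌈4 * c⌉₊ ∧ ∀ j, κ (j + 1) = 5 * κ j + 2 :=
    ⟨fun j => Nat.rec ⌈4 * c⌉₊ (fun _ k => 5 * k + 2) j, rfl, fun _ => rfl⟩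
  have hκle : ∀ j, κ j + 1 ≤ 5 ^ j * (⌈4 * c⌉₊ + 1) := by
    intro j
    induction j with
    | zero => simp [hκ0]
    | succ j ih => rw [hκ, pow_succ]; nlinarith
  have hn : (0 : ℝ) < Fintype.card V := by
    have : Nonempty V := ⟨v⟩
    exact_mod_cast Fintype.card_pos
  have hbig : ∃ j ≤ J, ∃ u, (Fintype.card V : ℝ) / 2 < (H.distBall u (4 * κ j + 1)).card := by
    by_contra! hsmall
    -- The bound solves the recursion N ↦ N²/(2c) started at 4c. The start holds because a ball of
    -- radius `k` that misses a vertex has more than `k` elements.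
    have hgrow : ∀ j ≤ J, ∀ u, 2 * c * 2 ^ 2 ^ j ≤ ((H.distBall u (κ j)).card : ℝ) := by
      intro j
      induction j with
      | zero =>
        intro _ u
        have h1 := hsmall 0 (Nat.zero_le _) u
        have h2 : ∃ x, x ∉ H.distBall u (4 * κ 0 + 1) := by
          by_contra! h
          rw [Finset.eq_univ_of_forall h, Finset.card_univ] at h1
          linarith
        obtain ⟨x, hx⟩ := h2
        rw [mem_distBall] at hx
        have h3 := hH.lt_card_distBall (show κ 0 ≤ H.dist u x by omega)
        have h4 : ((κ 0 : ℕ) : ℝ) ≤ (H.distBall u (κ 0)).card := by exact_mod_cast h3.le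
        have h5 := Nat.le_ceil (4 * c)
        rw [← hκ0] at h5
        norm_num
        linarith
      | succ j ih =>
        intro hj u
        have h1 := hH.sq_le_card_distBall (c := c) (k := κ j) (N := 2 * c * 2 ^ 2 ^ j)
          (fun W Z u x h => by simpa using hadd W Z u x 1 h) (by positivity)
          (ih (by omega)) u (hsmall j (by omega) u)
        rw [← hκ] at h1
        have h2 : (2 * c * 2 ^ 2 ^ j) ^ 2 = 2 * c * (2 * c * 2 ^ 2 ^ (j + 1)) := by
          rw [pow_succ 2 j, pow_mul]
          ring
        rw [h2] at h1
        exact le_of_mul_le_mul_left h1 (by positivity)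
    have h1 := hgrow J le_rfl v
    have h2 : ((H.distBall v (κ J)).card : ℝ) ≤ Fintype.card V := by
      exact_mod_cast Finset.card_le_univ _
    have h3 : (Fintype.card V : ℝ) ≤ 2 ^ 2 ^ J := by exact_mod_cast hJ
    nlinarith
  obtain ⟨j, hj, u, hu⟩ := hbig
  set M := 4 * κ j + 1 with hM
  have hecc : ∀ x, (H.dist u x : ℝ) ≤ 2 * M + 1 + 2 * c := by
    intro x
    -- A link from `x` to `u` brings `x` closer by this amount to each vertex of the ball, which
    -- holds more than n/2 vertices; so the amount is at most 2c.
    have h1 := hadd {x} (H.distBall u M) x u (H.dist u x - (2 * M + 1))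
    by_cases hlt : H.dist u x ≤ 2 * M + 1
    · have : (H.dist u x : ℝ) ≤ 2 * M + 1 := by exact_mod_cast hlt
      linarith
    · have h2 := h1 (by
        intro w hw z hz
        rw [Finset.mem_singleton] at hw
        subst hw
        rw [mem_distBall] at hz
        have := hH.dist_triangle (u := u) (v := z) (w := w)
        rw [dist_comm (u := z)] at this
        rw [dist_self]
        omega)
      rw [Finset.card_singleton, Nat.cast_sub (by omega)] at h2
      push_cast at h2
      have h3 : 0 ≤ (H.dist u x : ℝ) - (2 * M + 1) := by
        rw [sub_nonneg]
        exact_mod_cast (not_le.mp hlt).le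
      have h4 := mul_le_mul_of_nonneg_right hu.le h3
      have h5 : Fintype.card V * ((H.dist u x : ℝ) - (2 * M + 1)) ≤
          Fintype.card V * (2 * c) := by linarith
      have h6 := le_of_mul_le_mul_left h5 hn
      linarith
  have h1 : (H.dist v w : ℝ) ≤ H.dist u v + H.dist u w := by
    rw [dist_comm (u := u) (v := v)]
    exact_mod_cast hH.dist_triangle
  have h2 : (M : ℝ) ≤ 4 * (5 ^ J * (4 * c + 2)) := by
    have h3 : ((κ j : ℕ) : ℝ) + 1 ≤ 5 ^ j * (⌈4 * c⌉₊ + 1) := by exact_mod_cast hκle j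
    have h4 := (Nat.ceil_lt_add_one (show 0 ≤ 4 * c by positivity)).le
    have h5 : (5 : ℝ) ^ j ≤ 5 ^ J := pow_le_pow_right₀ (by norm_num) hj
    have h6 : (5 : ℝ) ^ j * (⌈4 * c⌉₊ + 1) ≤ 5 ^ J * (4 * c + 2) :=
      mul_le_mul h5 (by linarith) (by positivity) (by positivity)
    rw [hM]
    push_cast
    linarith
  have h3 : (4 * c + 2) ≤ 5 ^ J * (4 * c + 2) :=
    le_mul_of_one_le_left (by positivity) (one_le_pow₀ (by norm_num))
  linarith [hecc v, hecc w]

end SimpleGraph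

/-! ### The iterated logarithm -/

lemma two_pow_two_pow_ceil_logb {n : ℕ} (hn : 2 ≤ n) :
    n ≤ 2 ^ 2 ^ ⌈Real.logb 2 (Real.logb 2 n)⌉₊ := by
  have hn' : (2 : ℝ) ≤ n := by exact_mod_cast hn
  have h1 : 1 ≤ Real.logb 2 n := by
    rw [Real.le_logb_iff_rpow_le (by norm_num) (by linarith)]
    simpa using hn'
  have h2 := Nat.le_ceil (Real.logb 2 (Real.logb 2 n))
  rw [Real.logb_le_iff_le_rpow (by norm_num) (by linarith), Real.rpow_natCast,
    Real.logb_le_iff_le_rpow (by norm_num) (by linarith)] at h2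
  have h3 : (n : ℝ) ≤ 2 ^ ((2 ^ ⌈Real.logb 2 (Real.logb 2 n)⌉₊ : ℕ) : ℝ) := by
    push_cast
    exact h2
  rw [Real.rpow_natCast] at h3
  exact_mod_cast h3

/-- Since 5^(lg y) = y^(lg 5), only the rounding up remains, and it costs at most a factor 5. -/
lemma five_pow_ceil_logb_le {y : ℝ} (hy : 1 ≤ y) :
    (5 : ℝ) ^ ⌈Real.logb 2 y⌉₊ ≤ 5 * y ^ Real.logb 2 5 := by
  have h1 := (Nat.ceil_lt_add_one (Real.logb_nonneg (b := 2) (by norm_num) hy)).le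
  have h2 : (5 : ℝ) ^ Real.logb 2 y = y ^ Real.logb 2 5 := by
    rw [Real.rpow_def_of_pos (by norm_num), Real.rpow_def_of_pos (by linarith), Real.logb,
      Real.logb]
    ring_nf
  calc (5 : ℝ) ^ ⌈Real.logb 2 y⌉₊ = (5 : ℝ) ^ ((⌈Real.logb 2 y⌉₊ : ℕ) : ℝ) :=
        (Real.rpow_natCast _ _).symm
    _ ≤ 5 ^ (Real.logb 2 y + 1) := Real.rpow_le_rpow_of_exponent_le (by norm_num) h1
    _ = 5 * y ^ Real.logb 2 5 := by
      rw [Real.rpow_add (by norm_num), Real.rpow_one, h2, mul_comm]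

/-! ### Consequences of equilibrium -/

namespace CooperativeNetworkCreation

variable {V : Type*} [Fintype V] {G : SimpleGraph V}

lemma createdGraph_adj {α : ℝ≥0} {s : JointStrategy G} {u v : V} :
    (createdGraph α s).Adj u v ↔
      ∃ h : s(u, v) ∈ G.edgeSet, α ≤ totalOffer s ⟨s(u, v), h⟩ := by
  rw [createdGraph, SimpleGraph.fromEdgeSet_adj]
  exact ⟨fun h => h.1, fun h => ⟨h, ((SimpleGraph.mem_edgeSet G).mp h.1).ne⟩⟩

lemma mem_edgeSet_createdGraph {α : ℝ≥0} {s : JointStrategy G} {e : Sym2 V} :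
    e ∈ (createdGraph α s).edgeSet ↔ ∃ h : e ∈ G.edgeSet, α ≤ totalOffer s ⟨e, h⟩ := by
  induction e with
  | _ u v => exact createdGraph_adj

lemma usageCost_anti {H H' : SimpleGraph V} (h : H ≤ H') (i : V) :
    usageCost H' i ≤ usageCost H i :=
  Finset.sum_le_sum fun _ _ => ENat.toENNReal_mono (SimpleGraph.edist_anti h)

lemma totalOffer_congr {s t : JointStrategy G} {f : G.edgeSet} (h : ∀ i, t i f = s i f) :
    totalOffer t f = totalOffer s f :=
  Finset.sum_congr rfl fun i _ => h i

lemma payment_congr (α : ℝ≥0) {s t : JointStrategy G} {f : G.edgeSet} (h : ∀ i, t i f = s i f)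
    (i : V) : payment α t i f = payment α s i f := by
  simp only [payment, totalOffer_congr h, h]

lemma payment_le (α : ℝ≥0) (s : JointStrategy G) (i : V) (e : G.edgeSet) :
    payment α s i e ≤ s i e := by
  unfold payment
  split_ifs with h
  · refine NNReal.div_le_of_le_mul ?_
    rw [mul_comm]
    gcongr
  · exact zero_le

lemma sum_payment {α : ℝ≥0} {s : JointStrategy G} {e : G.edgeSet} (h : α ≤ totalOffer s e) :
    ∑ i, payment α s i e = α := by
  simp only [payment, if_pos h]
  rw [← Finset.sum_div, ← Finset.mul_sum, ← totalOffer]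
  -- A created link with no offers forces α = 0, and the payments 0/0 are then 0 as well.
  rcases eq_or_ne (totalOffer s e) 0 with h0 | h0
  · rw [h0] at h ⊢
    simpa using (le_antisymm h zero_le).symm
  · exact mul_div_cancel_right₀ _ h0

lemma createdGraph_deleteEdges_le {α : ℝ≥0} {s t : JointStrategy G} {e : G.edgeSet}
    (h : ∀ i f, f ≠ e → t i f = s i f) :
    (createdGraph α s).deleteEdges {(e : Sym2 V)} ≤ createdGraph α t := by
  intro u v huv
  rw [SimpleGraph.deleteEdges_adj, createdGraph_adj] at huv
  obtain ⟨⟨hG, hα⟩, hne⟩ := huv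
  rw [createdGraph_adj]
  refine ⟨hG, ?_⟩
  have hf : (⟨s(u, v), hG⟩ : G.edgeSet) ≠ e := fun h' =>
    hne (Set.mem_singleton_iff.mpr (congrArg Subtype.val h'))
  rwa [totalOffer_congr fun i => h i _ hf]

/-- Comparison of the costs before and after a change of offers on a single link. -/
lemma payment_add_usageCost_le {α : ℝ≥0} {s t : JointStrategy G} {e : G.edgeSet}
    (h : ∀ i f, f ≠ e → t i f = s i f) {i : V} (hfin : playerCost α s i ≠ ∞)
    (hle : playerCost α s i ≤ playerCost α t i) :
    payment α s i e + usageCost (createdGraph α s) i ≤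
      payment α t i e + usageCost (createdGraph α t) i := by
  classical
  unfold playerCost at hfin hle
  rw [← Finset.sum_erase_add _ _ (Finset.mem_univ e)] at hfin hle
  rw [← Finset.sum_erase_add _ _ (Finset.mem_univ e)] at hle
  rw [Finset.sum_congr (s₁ := Finset.univ.erase e) rfl fun f hf =>
    congrArg ((↑) : ℝ≥0 → ℝ≥0∞) (payment_congr α (fun i => h i f (Finset.ne_of_mem_erase hf)) i),
    add_assoc, add_assoc] at hle
  rw [add_assoc] at hfin
  exact (ENNReal.add_le_add_iff_left (ENNReal.add_ne_top.mp hfin).1).mp hle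

lemma IsCollaborativeEquilibrium.usageCost_ne_top {α : ℝ≥0} {s : JointStrategy G}
    (hs : IsCollaborativeEquilibrium α s) (i : V) : usageCost (createdGraph α s) i ≠ ∞ :=
  (ENNReal.add_ne_top.mp (hs.1 i)).2

lemma IsCollaborativeEquilibrium.edist_ne_top {α : ℝ≥0} {s : JointStrategy G}
    (hs : IsCollaborativeEquilibrium α s) (i j : V) : (createdGraph α s).edist i j ≠ ⊤ := by
  have h := ENNReal.sum_ne_top.mp (hs.usageCost_ne_top i) j (Finset.mem_univ j)
  simpa using h

lemma IsCollaborativeEquilibrium.connected [Nonempty V] {α : ℝ≥0} {s : JointStrategy G}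
    (hs : IsCollaborativeEquilibrium α s) : (createdGraph α s).Connected :=
  ⟨fun i j => SimpleGraph.reachable_of_edist_ne_top (hs.edist_ne_top i j)⟩

/-- In an equilibrium nobody pays more for a link than its deletion would cost them. -/
lemma IsCollaborativeEquilibrium.payment_add_usageCost_le_deleteEdges {α : ℝ≥0}
    {s : JointStrategy G} (hs : IsCollaborativeEquilibrium α s) (e : G.edgeSet) (i : V) :
    payment α s i e + usageCost (createdGraph α s) i ≤
      usageCost ((createdGraph α s).deleteEdges {(e : Sym2 V)}) i := by
  classical
  -- Player `i` alone withdraws the offer. The other offers may still suffice for the link, so the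
  -- new graph only contains the one with `e` deleted.
  let t : JointStrategy G := fun j f => if j = i ∧ f = e then 0 else s j f
  have ht : ∀ j f, f ≠ e → t j f = s j f := fun j f hf => by simp [t, hf]
  obtain ⟨j, hj, hle⟩ := hs.2 e {i} (Finset.singleton_nonempty i) t fun j f h => by
    by_contra hn
    exact h (by simpa [t] using fun h1 h2 => absurd ⟨by simpa using h1, h2⟩ hn)
  rw [Finset.mem_singleton] at hj
  subst hj
  have h1 := payment_add_usageCost_le ht (hs.1 j) hle
  have h2 : payment α t j e = 0 := by
    have := payment_le α t j e
    simpa [t] using this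
  rw [h2, ENNReal.coe_zero, zero_add] at h1
  exact h1.trans (usageCost_anti (createdGraph_deleteEdges_le ht) j)

/-- In an equilibrium the creation of a link decreases the usage cost by at most `α` in total. -/
lemma IsCollaborativeEquilibrium.sum_le_of_usageCost_add_le {α : ℝ≥0} {s : JointStrategy G}
    (hs : IsCollaborativeEquilibrium α s) (e : G.edgeSet)
    (C : Finset V) (δ : V → ℝ≥0)
    (hδ : ∀ i ∈ C, usageCost (createdGraph α s ⊔ SimpleGraph.fromEdgeSet {(e : Sym2 V)}) i + δ i ≤
      usageCost (createdGraph α s) i) : ∑ i ∈ C, δ i ≤ α := by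
  classical
  by_contra! hα
  set D := ∑ i ∈ C, δ i with hD
  have hDpos : 0 < D := lt_of_le_of_lt zero_le hα
  -- Every member of the coalition must gain strictly, so players with δ = 0 are left out.
  set C' := C.filter fun i => 0 < δ i with hC'
  have hsum : ∑ i ∈ C', δ i = D := by
    rw [hD, hC', Finset.sum_filter]
    refine Finset.sum_congr rfl fun i _ => ?_
    split_ifs with h
    · rfl
    · exact (le_antisymm (not_lt.mp h) zero_le).symm
  have hne : C'.Nonempty := by
    by_contra h
    rw [Finset.not_nonempty_iff_eq_empty.mp h, Finset.sum_empty] at hsum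
    exact hDpos.ne hsum
  -- Shares proportional to the gains add up to α, and each is below its owner's gain because α < D.
  let t : JointStrategy G := fun j f => if j ∈ C' ∧ f = e then α * δ j / D else s j f
  have ht : ∀ j f, f ≠ e → t j f = s j f := fun j f hf => by simp [t, hf]
  have hte : ∀ j ∈ C', t j e = α * δ j / D := fun j hj => by simp only [t, hj, and_self, if_true]
  have htot : α ≤ totalOffer t e := by
    have h1 : ∑ j ∈ C', t j e = α := by
      rw [Finset.sum_congr rfl hte, ← Finset.sum_div, ← Finset.mul_sum, hsum]
      exact mul_div_cancel_right₀ _ hDpos.ne'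
    rw [totalOffer]
    nth_rewrite 1 [← h1]
    exact Finset.sum_le_sum_of_subset (Finset.subset_univ _)
  have hle : createdGraph α s ⊔ SimpleGraph.fromEdgeSet {(e : Sym2 V)} ≤ createdGraph α t := by
    intro u v huv
    by_cases huve : s(u, v) = e
    · rw [createdGraph_adj]
      refine ⟨huve ▸ e.2, ?_⟩
      convert htot
    · refine (createdGraph_deleteEdges_le ht) ?_
      rw [SimpleGraph.deleteEdges_adj]
      rw [SimpleGraph.sup_adj, SimpleGraph.fromEdgeSet_adj] at huv
      exact ⟨huv.resolve_right fun h => huve h.1, huve⟩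
  obtain ⟨i, hi, hcost⟩ := hs.2 e C' hne t fun j f h => by
    by_contra hn
    exact h (by simp only [t, if_neg hn])
  have h1 := payment_add_usageCost_le ht (hs.1 i) hcost
  have h2 := hδ i (Finset.mem_filter.mp hi).1
  have h3 : usageCost (createdGraph α s ⊔ SimpleGraph.fromEdgeSet {(e : Sym2 V)}) i ≠ ∞ :=
    ne_top_of_le_ne_top (hs.usageCost_ne_top i) (usageCost_anti le_sup_left i)
  have h4 : usageCost (createdGraph α s ⊔ SimpleGraph.fromEdgeSet {(e : Sym2 V)}) i + δ i ≤
      usageCost (createdGraph α s ⊔ SimpleGraph.fromEdgeSet {(e : Sym2 V)}) i +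
        payment α t i e := by
    refine h2.trans (le_add_self.trans (h1.trans ?_))
    rw [add_comm]
    gcongr
    exact usageCost_anti hle i
  have h5 : δ i ≤ α * δ i / D := by
    have := (ENNReal.add_le_add_iff_left h3).mp h4
    rw [← hte i hi]
    exact (ENNReal.coe_le_coe.mp this).trans (payment_le α t i e)
  have hi0 : 0 < δ i := (Finset.mem_filter.mp hi).2
  refine absurd h5 (not_le.mpr ?_)
  rw [div_lt_iff₀ hDpos, mul_comm]
  exact mul_lt_mul_of_pos_left hα hi0

/-- In an equilibrium on a complete host graph, a link cannot shorten all distances between two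
sets of vertices if these sets are large. -/
lemma IsCollaborativeEquilibrium.card_mul_card_mul_le {α : ℝ≥0}
    {s : JointStrategy (⊤ : SimpleGraph V)} (hs : IsCollaborativeEquilibrium α s)
    (W Z : Finset V) (u x : V) (m : ℕ) (h : ∀ w ∈ W, ∀ z ∈ Z,
      (createdGraph α s).dist w u + 1 + (createdGraph α s).dist x z + m ≤
        (createdGraph α s).dist w z) :
    (W.card : ℝ≥0) * Z.card * m ≤ α := by
  classical
  have : Nonempty V := ⟨u⟩
  have hH := hs.connected
  -- There is no link to build here, but the triangle inequality leaves only empty `W` or `Z`.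
  by_cases hux : u = x
  · subst hux
    rcases W.eq_empty_or_nonempty with rfl | ⟨w, hw⟩
    · simp
    rcases Z.eq_empty_or_nonempty with rfl | ⟨z, hz⟩
    · simp
    have h1 := h w hw z hz
    have h2 := hH.dist_triangle (u := w) (v := u) (w := z)
    omega
  have key := hs.sum_le_of_usageCost_add_le ⟨s(u, x), by simpa using hux⟩ W
    (fun _ => Z.card * m) ?_
  · simpa [mul_assoc] using key
  intro w hw
  set H' := createdGraph α s ⊔ SimpleGraph.fromEdgeSet {s(u, x)} with hH'
  have hmono : createdGraph α s ≤ H' := le_sup_left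
  have hux1 : H'.edist u x ≤ 1 := by
    rw [SimpleGraph.edist_le_one_iff_adj_or_eq]
    left
    rw [hH', SimpleGraph.sup_adj, SimpleGraph.fromEdgeSet_adj]
    exact Or.inr ⟨rfl, hux⟩
  have hZ : (((Z.card * m : ℝ≥0)) : ℝ≥0∞) = ∑ z, if z ∈ Z then (m : ℝ≥0∞) else 0 := by
    simp
  rw [hZ]
  unfold usageCost
  rw [← Finset.sum_add_distrib]
  refine Finset.sum_le_sum fun z _ => ?_
  split_ifs with hz
  · have h1 : H'.edist w z + m ≤ (createdGraph α s).edist w z := by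
      rw [← (hH w z).coe_dist_eq_edist]
      refine le_trans ?_ (Nat.cast_le.mpr (h w hw z hz))
      push_cast
      refine add_le_add_left ?_ _
      refine (SimpleGraph.edist_triangle (v := x)).trans (add_le_add ?_ ?_)
      · refine (SimpleGraph.edist_triangle (v := u)).trans (add_le_add ?_ hux1)
        exact (SimpleGraph.edist_anti hmono).trans (hH w u).coe_dist_eq_edist.ge
      · exact (SimpleGraph.edist_anti hmono).trans (hH x z).coe_dist_eq_edist.ge
    exact_mod_cast ENat.toENNReal_mono h1
  · rw [add_zero]
    exact ENat.toENNReal_mono (SimpleGraph.edist_anti hmono)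

/-- In an equilibrium, a link around which there is a short detour costs at most the length of the
detour times the number of pairs of vertices whose chosen shortest path uses this link. -/
lemma IsCollaborativeEquilibrium.le_mul_card_of_detour {α : ℝ≥0} {s : JointStrategy G}
    (hs : IsCollaborativeEquilibrium α s) {L : ℕ} {e : Sym2 V}
    (he : e ∈ (createdGraph α s).edgeSet)
    (hL : ∀ x y, e = s(x, y) → ((createdGraph α s).deleteEdges {e}).edist x y ≤ L)
    (p : ∀ i j, (createdGraph α s).Walk i j) (hp : ∀ i j, (p i j).IsTrail)
    (hlen : ∀ i j, ((p i j).length : ℕ∞) = (createdGraph α s).edist i j) :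
    open Classical in
    (α : ℝ≥0∞) ≤ L * ∑ i, ∑ j, if e ∈ (p i j).edges then 1 else 0 := by
  classical
  obtain ⟨heG, hα⟩ := mem_edgeSet_createdGraph.mp he
  have h1 : (α : ℝ≥0∞) + ∑ i, usageCost (createdGraph α s) i ≤
      ∑ i, usageCost ((createdGraph α s).deleteEdges {e}) i := by
    have hsum : (α : ℝ≥0∞) = ∑ i, (payment α s i ⟨e, heG⟩ : ℝ≥0∞) := by
      exact_mod_cast (sum_payment hα).symm
    rw [hsum, ← Finset.sum_add_distrib]
    exact Finset.sum_le_sum fun i _ => hs.payment_add_usageCost_le_deleteEdges ⟨e, heG⟩ i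
  have h2 : ∑ i, usageCost ((createdGraph α s).deleteEdges {e}) i ≤
      L * (∑ i, ∑ j, if e ∈ (p i j).edges then 1 else 0) +
        ∑ i, usageCost (createdGraph α s) i := by
    rw [Finset.mul_sum, ← Finset.sum_add_distrib]
    refine Finset.sum_le_sum fun i _ => ?_
    unfold usageCost
    rw [Finset.mul_sum, ← Finset.sum_add_distrib]
    refine Finset.sum_le_sum fun j _ => ?_
    rw [← hlen i j]
    split_ifs with h
    · have := SimpleGraph.edist_deleteEdges_le_of_isTrail hL (p i j) (hp i j)
      rw [add_comm, mul_one]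
      exact_mod_cast ENat.toENNReal_mono this
    · have := SimpleGraph.edist_deleteEdges_le_of_notMem (p i j) h
      rw [mul_zero, zero_add]
      exact ENat.toENNReal_mono this
  exact (ENNReal.add_le_add_iff_right
    (ENNReal.sum_ne_top.mpr fun i _ => hs.usageCost_ne_top i)).mp (h1.trans h2)

/-- The links around which there is a short detour cost at most a constant times the total usage
cost. -/
lemma IsCollaborativeEquilibrium.mul_card_le_of_detour {α : ℝ≥0} {s : JointStrategy G}
    (hs : IsCollaborativeEquilibrium α s) {L : ℕ} (E : Finset (Sym2 V))
    (hE : ∀ e ∈ E, e ∈ (createdGraph α s).edgeSet ∧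
      ∀ x y, e = s(x, y) → ((createdGraph α s).deleteEdges {e}).edist x y ≤ L) :
    (α : ℝ≥0∞) * E.card ≤ L * ∑ i, usageCost (createdGraph α s) i := by
  classical
  have hpath : ∀ i j, ∃ p : (createdGraph α s).Walk i j, p.IsTrail ∧
      (p.length : ℕ∞) = (createdGraph α s).edist i j := by
    intro i j
    obtain ⟨p, hp⟩ := SimpleGraph.exists_walk_of_edist_ne_top (hs.edist_ne_top i j)
    refine ⟨p.bypass, p.bypass_isPath.isTrail, le_antisymm ?_ (SimpleGraph.edist_le _)⟩
    rw [← hp]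
    exact_mod_cast p.length_bypass_le_length
  choose p hp hlen using hpath
  have h1 : (α : ℝ≥0∞) * E.card ≤
      ∑ e ∈ E, (L : ℝ≥0∞) * ∑ i, ∑ j, if e ∈ (p i j).edges then 1 else 0 := by
    rw [mul_comm, ← nsmul_eq_mul]
    exact Finset.card_nsmul_le_sum _ _ _ fun e he =>
      hs.le_mul_card_of_detour (hE e he).1 (hE e he).2 p hp hlen
  refine h1.trans ?_
  -- Count by pairs instead of links: the path chosen for (i, j) contains at most d(i, j) links of
  -- `E`.
  rw [← Finset.mul_sum, Finset.sum_comm]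
  gcongr with i
  rw [Finset.sum_comm, usageCost]
  gcongr with j
  rw [← hlen i j, Finset.sum_boole]
  have h2 : (E.filter fun e => e ∈ (p i j).edges).card ≤ (p i j).length := by
    rw [← SimpleGraph.Walk.length_edges]
    refine (Finset.card_le_card fun e he => ?_).trans (List.toFinset_card_le _)
    exact List.mem_toFinset.mpr (Finset.mem_filter.mp he).2
  exact_mod_cast h2

/-- In an equilibrium the total cost is at most `2 α n` plus `O(log n)` times the usage cost. -/
lemma IsCollaborativeEquilibrium.totalCost_le {α : ℝ≥0} {s : JointStrategy G}
    (hs : IsCollaborativeEquilibrium α s) :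
    totalCost α s ≤ α * (2 * Fintype.card V) +
      ((2 * Nat.log 2 (Fintype.card V) + 2 : ℕ) : ℝ≥0∞) *
        ∑ i, usageCost (createdGraph α s) i := by
  classical
  set H := createdGraph α s with hH
  set L := 2 * Nat.log 2 (Fintype.card V) + 1 with hL
  let E : Finset (Sym2 V) := H.edgeFinset.filter fun e =>
    ∀ x y, e = s(x, y) → (H.deleteEdges {e}).edist x y ≤ L
  let F : SimpleGraph V :=
    { Adj := fun x y => H.Adj x y ∧ (L : ℕ∞) < (H.deleteEdges {s(x, y)}).edist x y
      symm := ⟨fun x y h => ⟨h.1.symm, by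
        rw [Sym2.eq_swap, SimpleGraph.edist_comm]; exact h.2⟩⟩
      loopless := ⟨fun x h => h.1.ne rfl⟩ }
  have hFH : F ≤ H := fun x y h => h.1
  have hF : F.edgeSet.ncard ≤ 2 * Fintype.card V := by
    rw [← Finset.card_univ]
    exact SimpleGraph.ncard_edgeSet_le_of_forall_lt_edist hL.ge _ Finset.univ F le_rfl
      (fun x y h => h.2.trans_le (SimpleGraph.edist_anti (SimpleGraph.deleteEdges_mono hFH)))
      (fun x y _ => Finset.mem_univ x)
  have hsub : H.edgeSet ⊆ (E : Set (Sym2 V)) ∪ F.edgeSet := by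
    intro e he
    by_cases h : e ∈ E
    · exact Or.inl h
    · right
      simp only [E, Finset.mem_filter, SimpleGraph.mem_edgeFinset, he, true_and, not_forall,
        not_le] at h
      obtain ⟨x, y, rfl, h⟩ := h
      exact ⟨he, h⟩
  have hcard : H.edgeSet.ncard ≤ E.card + 2 * Fintype.card V := by
    refine (Set.ncard_le_ncard hsub (Set.toFinite _)).trans ((Set.ncard_union_le _ _).trans ?_)
    rw [Set.ncard_coe_finset]
    omega
  have hE := hs.mul_card_le_of_detour (L := L) E fun e he => by
    simpa [E] using he
  have hα : (α : ℝ≥0∞) * H.edgeSet.ncard ≤ α * E.card + α * (2 * Fintype.card V) := by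
    rw [← mul_add]
    gcongr
    exact_mod_cast hcard
  calc totalCost α s = α * H.edgeSet.ncard + ∑ i, usageCost H i := rfl
    _ ≤ (L * ∑ i, usageCost H i + α * (2 * Fintype.card V)) + ∑ i, usageCost H i := by
      gcongr
      exact hα.trans (by gcongr)
    _ = _ := by
      rw [hL]
      push_cast
      ring

/-! ### From the diameter to the price of anarchy -/

/-- Every joint strategy costs at least about `α n + n ^ 2`. -/
lemma le_two_mul_totalCost (hV : 2 ≤ Fintype.card V) (α : ℝ≥0) (t : JointStrategy G) :
    (α : ℝ≥0∞) * Fintype.card V + (Fintype.card V : ℝ≥0∞) * Fintype.card V ≤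
      2 * totalCost α t := by
  classical
  have : Nonempty V := Fintype.card_pos_iff.mp (by omega)
  have hn : (Fintype.card V : ℝ≥0∞) ≤ 2 * ((Fintype.card V - 1 : ℕ) : ℝ≥0∞) := by
    exact_mod_cast (by omega : Fintype.card V ≤ 2 * (Fintype.card V - 1))
  have husage : ∀ i, ((Fintype.card V - 1 : ℕ) : ℝ≥0∞) ≤ usageCost (createdGraph α t) i := by
    intro i
    have h1 : ((Fintype.card V - 1 : ℕ) : ℝ≥0∞) = ∑ j ∈ Finset.univ.erase i, 1 := by
      simp [Finset.card_erase_of_mem]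
    rw [h1, usageCost]
    refine (Finset.sum_le_sum fun j hj => ?_).trans
      (Finset.sum_le_sum_of_subset (Finset.erase_subset i _))
    have h2 := Order.one_le_iff_pos.mpr
      (SimpleGraph.edist_pos_of_ne (G := createdGraph α t) (Finset.ne_of_mem_erase hj).symm)
    exact_mod_cast ENat.toENNReal_mono h2
  have hsum : (Fintype.card V : ℝ≥0∞) * Fintype.card V ≤
      2 * ∑ i, usageCost (createdGraph α t) i := by
    calc (Fintype.card V : ℝ≥0∞) * Fintype.card V
        ≤ Fintype.card V * (2 * ((Fintype.card V - 1 : ℕ) : ℝ≥0∞)) := by gcongr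
      _ = 2 * ∑ _i : V, ((Fintype.card V - 1 : ℕ) : ℝ≥0∞) := by
        rw [Finset.sum_const, Finset.card_univ, nsmul_eq_mul]
        ring
      _ ≤ _ := by
        gcongr with i
        exact husage i
  rw [totalCost, mul_add]
  by_cases hconn : (createdGraph α t).Connected
  · refine add_le_add ?_ hsum
    have h1 := hconn.card_vert_le_card_edgeSet_add_one
    rw [Nat.card_eq_fintype_card, Nat.card_coe_set_eq] at h1
    have h2 : Fintype.card V ≤ 2 * (createdGraph α t).edgeSet.ncard := by omega
    rw [mul_left_comm]
    gcongr
    exact_mod_cast h2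
  · have h1 : ∑ i, usageCost (createdGraph α t) i = ∞ := by
      by_contra h
      refine hconn ⟨fun i j => SimpleGraph.reachable_of_edist_ne_top fun hij => ?_⟩
      have h2 := ENNReal.sum_ne_top.mp h i (Finset.mem_univ i)
      have h3 := ENNReal.sum_ne_top.mp h2 j (Finset.mem_univ j)
      simp [hij] at h3
    rw [h1, ENNReal.mul_top two_ne_zero, add_top]
    exact le_top

/-- An upper bound on the diameter of equilibria yields an upper bound on the price of anarchy. -/
lemma priceOfAnarchy_le (hV : 2 ≤ Fintype.card V) {α : ℝ≥0} {D : ℝ≥0∞}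
    (hD : ∀ s : JointStrategy G, IsCollaborativeEquilibrium α s →
      ((createdGraph α s).ediam : ℝ≥0∞) ≤ D) :
    priceOfAnarchy G α ≤
      2 * (2 + ((2 * Nat.log 2 (Fintype.card V) + 2 : ℕ) : ℝ≥0∞) * D) := by
  set l : ℝ≥0∞ := ((2 * Nat.log 2 (Fintype.card V) + 2 : ℕ) : ℝ≥0∞) with hl
  set n : ℝ≥0∞ := (Fintype.card V : ℝ≥0∞) with hn
  refine ENNReal.div_le_of_le_mul (iSup_le fun s => ?_)
  have h1 : ∑ i, usageCost (createdGraph α s.1) i ≤ n * (n * D) := by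
    have h2 : ∀ i, usageCost (createdGraph α s.1) i ≤ n * D := by
      intro i
      rw [hn, ← nsmul_eq_mul]
      exact Finset.sum_le_card_nsmul _ _ _ fun j _ =>
        (ENat.toENNReal_mono SimpleGraph.edist_le_ediam).trans (hD s.1 s.2)
    rw [hn, ← nsmul_eq_mul]
    exact Finset.sum_le_card_nsmul _ _ _ fun i _ => h2 i
  have h2 : α * n + n * n ≤ 2 * ⨅ t : JointStrategy G, totalCost α t := by
    rw [ENNReal.mul_iInf_of_ne two_ne_zero (by simp)]
    exact le_iInf fun t => le_two_mul_totalCost hV α t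
  calc totalCost α s.1 ≤ α * (2 * n) + l * (n * (n * D)) :=
        s.2.totalCost_le.trans (by gcongr)
    _ ≤ (2 + l * D) * (α * n + n * n) := by
      have : (2 + l * D) * (α * n + n * n) =
        α * (2 * n) + l * (n * (n * D)) + (2 * (n * n) + l * D * (α * n)) := by ring
      rw [this]
      exact le_self_add
    _ ≤ (2 + l * D) * (2 * ⨅ t : JointStrategy G, totalCost α t) := by gcongr
    _ = _ := by ring

/-- Equilibria on complete host graphs have polylogarithmic diameter. -/
lemma IsCollaborativeEquilibrium.ediam_le {α : ℝ≥0} {s : JointStrategy (⊤ : SimpleGraph V)}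
    (hs : IsCollaborativeEquilibrium α s) {c : ℝ} (hc : 1 ≤ c)
    (hα : (α : ℝ) ≤ c * Fintype.card V) (hV : 2 ≤ Fintype.card V) :
    ((createdGraph α s).ediam : ℝ≥0∞) ≤ ENNReal.ofReal
      (100 * (4 * c + 2) * Real.logb 2 (Fintype.card V) ^ Real.logb 2 5) := by
  have : Nonempty V := Fintype.card_pos_iff.mp (by omega)
  have hH := hs.connected
  have hlog : 1 ≤ Real.logb 2 (Fintype.card V) := by
    have h2 : (2 : ℝ) ≤ Fintype.card V := by exact_mod_cast hV
    rw [Real.le_logb_iff_rpow_le (by norm_num) (by linarith)]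
    simpa using h2
  have hdist : ∀ v w, ((createdGraph α s).dist v w : ℝ) ≤
      100 * (4 * c + 2) * Real.logb 2 (Fintype.card V) ^ Real.logb 2 5 := by
    intro v w
    have h1 := hH.dist_le_of_forall_card_mul_card_le hc
      (fun W Z u x m h => le_trans (by exact_mod_cast hs.card_mul_card_mul_le W Z u x m h) hα)
      (two_pow_two_pow_ceil_logb hV) v w
    have h2 := mul_le_mul_of_nonneg_left (five_pow_ceil_logb_le hlog)
      (show 0 ≤ 20 * (4 * c + 2) by positivity)
    linarith
  obtain ⟨v, w, hvw⟩ := (createdGraph α s).exists_edist_eq_ediam_of_finite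
  rw [← hvw, ← (hH v w).coe_dist_eq_edist]
  refine ENNReal.le_ofReal_iff_toReal_le (by simp) ?_ |>.mpr ?_
  · exact (Nat.cast_nonneg _).trans (hdist v w)
  · simpa using hdist v w

end CooperativeNetworkCreation

theorem mainTheorem1 :
    ∀ c : ℝ, 0 < c → ∃ K : ℝ, 0 < K ∧
      ∀ (n : ℕ) (α : ℝ≥0), (α : ℝ) ≤ c * n →
        (∀ s : CooperativeNetworkCreation.JointStrategy (⊤ : SimpleGraph (Fin n)),
          CooperativeNetworkCreation.IsCollaborativeEquilibrium α s →
            ((CooperativeNetworkCreation.createdGraph α s).ediam : ℝ≥0∞) ≤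
              ENNReal.ofReal (K * Real.logb 2 n ^ Real.logb 2 5)) ∧
        CooperativeNetworkCreation.priceOfAnarchy (⊤ : SimpleGraph (Fin n)) α ≤
          ENNReal.ofReal (K * Real.logb 2 n ^ (1 + Real.logb 2 5)) := by
  intro c hc
  -- The bound on distances is stated for constants at least 1.
  set c' := max c 1 with hc'
  have hc1 : 1 ≤ c' := le_max_right _ _
  set K := 100 * (4 * c' + 2) with hK
  have hKpos : 0 < K := by positivity
  -- From 2(2 + 4l · K l^(lg 5)) with l = lg n ≥ 1, where 4l bounds the factor 2 log n + 2.
  refine ⟨4 + 8 * K, by positivity, fun n α hα => ?_⟩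
  rcases lt_or_ge n 2 with hn | hn
  · have : Subsingleton (Fin n) := Fin.subsingleton_iff_le_one.mpr (by omega)
    refine ⟨fun s _ => by simp [SimpleGraph.ediam_eq_zero_of_subsingleton], ?_⟩
    -- With at most one player all costs vanish, and 0/0 is 0 in `ℝ≥0∞`.
    have hcost : ∀ s : CooperativeNetworkCreation.JointStrategy (⊤ : SimpleGraph (Fin n)),
        CooperativeNetworkCreation.totalCost α s = 0 := by
      intro s
      have h1 : CooperativeNetworkCreation.createdGraph α s = ⊥ := Subsingleton.elim _ _
      have h2 : ∀ i j : Fin n, (⊥ : SimpleGraph (Fin n)).edist i j = 0 := fun i j =>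
        SimpleGraph.edist_eq_zero_iff.mpr (Subsingleton.elim i j)
      simp [CooperativeNetworkCreation.totalCost, h1, CooperativeNetworkCreation.usageCost, h2]
    simp [CooperativeNetworkCreation.priceOfAnarchy, hcost]
  · have hn' : (2 : ℝ) ≤ n := by exact_mod_cast hn
    set l := Real.logb 2 n with hl
    have hlog : 1 ≤ l := by
      rw [Real.le_logb_iff_rpow_le (by norm_num) (by linarith)]
      simpa using hn'
    have hα' : (α : ℝ) ≤ c' * Fintype.card (Fin n) := by
      rw [Fintype.card_fin]
      exact hα.trans (mul_le_mul_of_nonneg_right (le_max_left _ _) (Nat.cast_nonneg _))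
    have hdiam : ∀ s : CooperativeNetworkCreation.JointStrategy (⊤ : SimpleGraph (Fin n)),
        CooperativeNetworkCreation.IsCollaborativeEquilibrium α s →
        ((CooperativeNetworkCreation.createdGraph α s).ediam : ℝ≥0∞) ≤
          ENNReal.ofReal (K * l ^ Real.logb 2 5) := by
      intro s hs
      simpa using hs.ediam_le hc1 hα' (by simpa using hn)
    have hl0 : 1 ≤ l ^ Real.logb 2 5 :=
      Real.one_le_rpow hlog (Real.logb_nonneg (by norm_num) (by norm_num))
    refine ⟨fun s hs => (hdiam s hs).trans (ENNReal.ofReal_le_ofReal ?_), ?_⟩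
    · exact mul_le_mul_of_nonneg_right (by linarith) (by positivity)
    · refine (CooperativeNetworkCreation.priceOfAnarchy_le (by simpa using hn) hdiam).trans ?_
      have h1 : ((2 * Nat.log 2 n + 2 : ℕ) : ℝ) ≤ 4 * l := by
        have := Real.natLog_le_logb n 2
        push_cast at this ⊢
        linarith
      rw [Fintype.card_fin, ← ENNReal.ofReal_natCast, ← ENNReal.ofReal_mul (by positivity),
        show (2 : ℝ≥0∞) = ENNReal.ofReal 2 by simp, ← ENNReal.ofReal_add (by positivity)
        (by positivity), ← ENNReal.ofReal_mul (by positivity)]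
      refine ENNReal.ofReal_le_ofReal ?_
      rw [Real.rpow_add (by linarith), Real.rpow_one]
      have h2 := mul_le_mul_of_nonneg_right h1 (show 0 ≤ K * l ^ Real.logb 2 5 by positivity)
      have h3 : 1 ≤ l * l ^ Real.logb 2 5 := one_le_mul_of_one_le_of_one_le hlog hl0
      linarith
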